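/- Let $d\ge 2$ and let $K_1,\dots,K_n$ be closed convex sets in $\mathbb{R}^d$ whose intersection $K=K_1\cap\dots\cap K_n$ is a convex body, that is, compact and convex with nonempty interior. For $\sigma\subset[n]=\{1,\dots,n\}$ write $K_\sigma=\bigcap_{i\in\sigma}K_i$, and for $A\subset\mathbb{R}^d$ write $A^\circ=\{p\in\mathbb{R}^d:\langle p,x\rangle\le 1\text{ for all }x\in A\}$. For convex bodies $A\subset B$ in $\mathbb{R}^d$, their homothetic distance is $$\inf\{|t|:\ t\in\mathbb{R},\ A-z\subset B-z\subset t(A-z)\text{ for some }z\in\mathbb{R}^d\}.$$ Then there are a point $z$ in the interior of $K$ and a real number $\lambda$ with $1\le\lambda\le d$ such that: 1. $(K-z)^\circ\subset-\lambda(K-z)^\circ$; 2. there is a set $\sigma\subset[n]$ with $|\sigma|\le 2d+1$ such that $$K_\sigma-z\subset-(\lambda+1)(d+1)(K-z)\subset-4d^2(K-z);$$ 3. there is a set $\mu\subset[n]$ with $|\mu|\le 2d$ such that $$K_\mu-z\subset-(\lambda+1)(2d^2+2d+1)(K-z)\subset-8d^3(K-z).$$ Moreover, $K_\sigma$ and $K_\mu$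 are then convex bodies, and their homothetic distances from $K$ are at most $(\lambda+1)(d+1)\le 4d^2$ and $(\lambda+1)(2d^2+2d+1)\le 8d^3$, respectively. -/

import Mathlib

open scoped Pointwise

/-- The polar `{p : ⟨p, x⟩ ≤ 1 for all x ∈ A}` of a set in `ℝᵈ` (one-sided: no absolute value). -/
def convexPolar {d : ℕ} (A : Set (EuclideanSpace ℝ (Fin d))) :
    Set (EuclideanSpace ℝ (Fin d)) :=
  {p | ∀ x ∈ A, inner ℝ p x ≤ 1}

/-- A convex body: a compact convex set with nonempty interior. -/
structure IsFullConvexBody {d : ℕ} (A : Set (EuclideanSpace ℝ (Fin d))) : Prop where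
  convex : Convex ℝ A
  isCompact : IsCompact A
  nonempty_interior : (interior A).Nonempty

/-- `K_σ`, the intersection of the subfamily indexed by `σ`. -/
def subfamilyInter {d n : ℕ} (K : Fin n → Set (EuclideanSpace ℝ (Fin d)))
    (σ : Finset (Fin n)) : Set (EuclideanSpace ℝ (Fin d)) :=
  ⋂ i ∈ σ, K i

/-- The homothetic distance of convex bodies `A ⊆ B`: the infimum of `|t|` over the real `t`
(of either sign) for which some `z` satisfies `A - z ⊆ B - z ⊆ t (A - z)`. -/
noncomputable def homotheticDist {d : ℕ} (A B : Set (EuclideanSpace ℝ (Fin d))) : ℝ :=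
  sInf {r : ℝ | ∃ (z : EuclideanSpace ℝ (Fin d)) (t : ℝ), r = |t| ∧
    A - {z} ⊆ B - {z} ∧ B - {z} ⊆ t • (A - {z})}

/-! By Helly, some interior point `z` of `K` has Minkowski asymmetry at most `d`, so `lam = d`
works. With `z` moved to the origin, let `X` be the union of the polars of the `K i`: its polar is
`K`, and `X ⊆ -lam • conv X`. A basis `b` of maximal determinant in `X` gives every `p ∈ X`
coordinates `cᵢ ∈ [-1, 1]`. The ray through `u = -∑ bᵢ` leaves `conv X` at a boundary point, which
Carathéodory writes with only `d` points of `X`. If `x` satisfies these `2d` constraints, then `-⟨p,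
x⟩ = ∑ (1 - cᵢ)⟨bᵢ, x⟩ + ⟨u, x⟩ ≤ 2d + lam * d`. Each constraint comes from one `K i`, so `2d` sets
suffice, with factor `d(d + 2)`. -/

section SparsePolar

variable {E : Type*} [NormedAddCommGroup E] [InnerProductSpace ℝ E] [FiniteDimensional ℝ E]

/-! ### Convex hulls, bipolars, bases and Carathéodory -/

/-- In finite dimension the convex hull of a compact set is compact. -/
theorem isCompact_convexHull_of_isCompact {X : Set E} (hX : IsCompact X) :
    IsCompact (convexHull ℝ X) := by
  classical
  rcases X.eq_empty_or_nonempty with rfl | ⟨x₀, hx₀⟩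
  · simp
  set m := Module.finrank ℝ E + 1
  let f : (Fin m → ℝ) × (Fin m → E) → E := fun q => ∑ i, q.1 i • q.2 i
  have hf : Continuous f := by fun_prop
  have hS : IsCompact (stdSimplex ℝ (Fin m) ×ˢ Set.univ.pi fun _ : Fin m => X) :=
    (isCompact_stdSimplex ℝ _).prod (isCompact_univ_pi fun _ => hX)
  convert hS.image hf using 1
  apply Set.Subset.antisymm
  · intro x hx
    obtain ⟨ι, _, z, w, hz, hind, hw, hw1, rfl⟩ := eq_pos_convex_span_of_mem_convexHull hx
    have hcard : Fintype.card ι ≤ Fintype.card (Fin m) := by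
      rw [Fintype.card_fin]
      exact hind.card_le_finrank_succ.trans
        (Nat.add_le_add_right (Submodule.finrank_le _) 1)
    obtain ⟨e⟩ := Function.Embedding.nonempty_of_card_le hcard
    -- Shorter combinations are padded to `m` terms with weight `0` at `x₀`.
    have hw' : ∀ i, Function.extend e w 0 (e i) = w i := fun i => e.injective.extend_apply _ _ _
    have hw0 : ∀ j, j ∉ Set.range e → Function.extend e w 0 j = 0 := fun j hj => by
      rw [Function.extend_apply' _ _ _ (by simpa using hj)]; rfl
    have hz' : ∀ i, Function.extend e z (fun _ => x₀) (e i) = z i :=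
      fun i => e.injective.extend_apply _ _ _
    refine ⟨(Function.extend e w 0, Function.extend e z fun _ => x₀), ⟨⟨?_, ?_⟩, ?_⟩, ?_⟩
    · intro j
      by_cases hj : j ∈ Set.range e
      · obtain ⟨i, rfl⟩ := hj
        simpa [hw'] using (hw i).le
      · simp [hw0 j hj]
    · simp only
      rw [← hw1]
      exact (Fintype.sum_of_injective e e.injective _ _ hw0 fun i => (hw' i).symm).symm
    · intro j _
      by_cases hj : j ∈ Set.range e
      · obtain ⟨i, rfl⟩ := hj
        simpa [hz'] using hz ⟨i, rfl⟩
      · simp only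
        rw [Function.extend_apply' _ _ _ (by simpa using hj)]
        exact hx₀
    · simp only [f]
      refine (Fintype.sum_of_injective e e.injective _ _ (fun j hj => ?_) fun i => ?_).symm
      · rw [hw0 j hj, zero_smul]
      · rw [hw', hz']
  · rintro _ ⟨⟨w, z⟩, ⟨⟨hw, hw1⟩, hz⟩, rfl⟩
    exact (convex_convexHull ℝ X).sum_mem (fun i _ => hw i) hw1
      fun i _ => subset_convexHull ℝ X (hz i trivial)

/-- The nontrivial inclusion of the bipolar theorem. -/
theorem mem_of_forall_polar_inner_le_one {C : Set E} (hC : Convex ℝ C) (hcl : IsClosed C)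
    (h0 : (0 : E) ∈ C) {q : E}
    (hq : ∀ x : E, (∀ p ∈ C, inner ℝ p x ≤ 1) → inner ℝ q x ≤ 1) : q ∈ C := by
  by_contra hqC
  obtain ⟨f, u, hfu, huq⟩ := geometric_hahn_banach_closed_point hC hcl hqC
  have hu : 0 < u := by simpa using hfu 0 h0
  have key : ∀ p, inner ℝ p (u⁻¹ • (InnerProductSpace.toDual ℝ E).symm f) = u⁻¹ * f p := by
    intro p
    rw [real_inner_smul_right, real_inner_comm, InnerProductSpace.toDual_symm_apply]
  have h := hq (u⁻¹ • (InnerProductSpace.toDual ℝ E).symm f) fun p hp => by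
    rw [key, inv_mul_le_iff₀ hu, mul_one]
    exact (hfu p hp).le
  rw [key, inv_mul_le_iff₀ hu, mul_one] at h
  linarith

/-- A compact spanning set contains a basis in which all its points have coordinates
of absolute value at most one. -/
theorem exists_basis_abs_repr_le_one {X : Set E} (hX : IsCompact X)
    (hspan : Submodule.span ℝ X = ⊤) :
    ∃ b : Module.Basis (Fin (Module.finrank ℝ E)) ℝ E,
      (∀ i, b i ∈ X) ∧ ∀ p ∈ X, ∀ i, |b.repr p i| ≤ 1 := by
  classical
  set m := Module.finrank ℝ E with hm
  obtain ⟨c, hc⟩ : ∃ c : Module.Basis (Fin m) ℝ E, ∀ i, c i ∈ X := by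
    let c := Module.Basis.ofSpan hspan.ge
    have : Fintype _ := FiniteDimensional.fintypeBasisIndex c
    refine ⟨c.reindex (Fintype.equivFinOfCardEq (Module.finrank_eq_card_basis c).symm), ?_⟩
    intro i
    rw [Module.Basis.reindex_apply]
    exact Module.Basis.ofSpan_subset hspan.ge ⟨_, rfl⟩
  have hcont : Continuous fun v : Fin m → E => |c.det v| := by
    simp only [Module.Basis.det_apply]
    refine (Continuous.matrix_det ?_).abs
    refine continuous_matrix fun i j => ?_
    simp only [Module.Basis.toMatrix_apply]
    exact (LinearMap.continuous_of_finiteDimensional (c.coord i)).comp (continuous_apply j)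
  -- By Cramer's rule, replacing `w i` by `p` multiplies the determinant by the `i`-th coordinate of
  -- `p`; maximality bounds that factor by 1.
  obtain ⟨w, hw, hmax⟩ := (isCompact_univ_pi fun _ : Fin m => hX).exists_isMaxOn
    ⟨c, fun i _ => hc i⟩ hcont.continuousOn
  have hpos : 0 < |c.det w| := by
    have := hmax (show (c : Fin m → E) ∈ _ from fun i _ => hc i)
    simp only [Set.mem_ofPred_eq, Module.Basis.det_self, abs_one] at this
    linarith
  have hdet : IsUnit (c.det w) := (abs_pos.1 hpos).isUnit
  obtain ⟨hli, hsp⟩ := (c.is_basis_iff_det).2 hdet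
  refine ⟨Module.Basis.mk hli hsp.ge, fun i => by simpa using hw i trivial, fun p hp i => ?_⟩
  have h1 := congrArg (fun φ => φ p) (c.det_smul_mk_coord_eq_det_update hli hsp.ge i)
  simp only [LinearMap.smul_apply, Module.Basis.coord_apply, smul_eq_mul,
    MultilinearMap.toLinearMap_apply] at h1
  have h2 := hmax (show Function.update w i p ∈ _ from fun j _ => by
    by_cases hj : j = i
    · subst hj; simpa using hp
    · simpa [hj] using hw j trivial)
  simp only [Set.mem_ofPred_eq] at h2
  have h3 : |c.det w| * |(Module.Basis.mk hli hsp.ge).repr p i| ≤ |c.det w| * 1 := by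
    rw [← abs_mul, h1, mul_one]
    exact h2
  exact le_of_mul_le_mul_left h3 hpos

/-- Carathéodory's theorem for points that are not interior to the convex hull. -/
theorem exists_finset_card_le_finrank_of_notMem_interior {X : Set E} {y : E}
    (hy : y ∈ convexHull ℝ X) (hy' : y ∉ interior (convexHull ℝ X)) :
    ∃ T : Finset E, (T : Set E) ⊆ X ∧ T.card ≤ Module.finrank ℝ E ∧
      y ∈ convexHull ℝ (T : Set E) := by
  classical
  obtain ⟨ι, _, z, w, hz, hind, hw, hw1, rfl⟩ := eq_pos_convex_span_of_mem_convexHull hy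
  refine ⟨Finset.univ.image z, by simpa using hz, ?_, ?_⟩
  · refine Finset.card_image_le.trans ?_
    rw [Finset.card_univ]
    by_contra! hlt
    have hcard : Fintype.card ι = Module.finrank ℝ E + 1 :=
      le_antisymm (hind.card_le_finrank_succ.trans
        (Nat.add_le_add_right (Submodule.finrank_le _) 1)) hlt
    -- With `finrank + 1` points and all weights positive, `y` would be interior to a full simplex.
    let b : AffineBasis ι ℝ E :=
      ⟨z, hind, (hind.affineSpan_eq_top_iff_card_eq_finrank_add_one).2 hcard⟩
    have hb : ⇑b = z := rfl
    apply hy'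
    apply interior_mono (convexHull_mono hz)
    rw [← hb, b.interior_convexHull]
    intro i
    have := b.coord_apply_combination_of_mem (Finset.mem_univ i) hw1
    rw [Finset.affineCombination_eq_linear_combination _ _ _ hw1, hb] at this
    rw [hb, this]
    exact hw i
  · exact (convex_convexHull ℝ _).sum_mem (fun i _ => (hw i).le) hw1
      fun i _ => subset_convexHull ℝ _ (by simp)

/-! ### Sparse approximation in the polar -/

/-- Sparse approximation: if `X ⊆ -lam • conv X`, then at most `2 * finrank` points of `X`
determine a polar contained in a multiple of the reflected polar of `X`. -/
theorem exists_sparse_polar_subset [Nontrivial E] {X : Set E} (hX : IsCompact X)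
    (hspan : Submodule.span ℝ X = ⊤) {lam : ℝ} (hlam : 0 < lam)
    (hsym : ∀ p ∈ X, -(lam⁻¹ • p) ∈ convexHull ℝ X) :
    ∃ T : Finset E, (T : Set E) ⊆ X ∧ T.card ≤ 2 * Module.finrank ℝ E ∧
      ∀ x : E, (∀ t ∈ T, inner ℝ t x ≤ 1) →
        ∀ p ∈ X, -inner ℝ p x ≤ (lam + 2) * Module.finrank ℝ E := by
  classical
  set m := Module.finrank ℝ E with hm
  obtain ⟨b, hbX, hb⟩ : ∃ b : Module.Basis (Fin m) ℝ E, _ :=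
    exists_basis_abs_repr_le_one hX hspan
  have hm0 : 0 < m := Module.finrank_pos
  have hmR : (0 : ℝ) < m := by exact_mod_cast hm0
  set C := convexHull ℝ X with hCdef
  have hC : IsCompact C := isCompact_convexHull_of_isCompact hX
  set u : E := -∑ i, b i with hu
  have hu0 : u ≠ 0 := by
    intro h
    have h1 : ∑ i, b i = 0 := neg_eq_zero.1 h
    have h2 := congrArg (fun v => b.repr v ⟨0, hm0⟩) h1
    simp [Finsupp.single_apply] at h2
  set s₀ : ℝ := (lam * m)⁻¹ with hs₀
  have hs₀pos : 0 < s₀ := by positivity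
  -- `s₀ • u` is the average of the points `-(lam⁻¹ • b i)`.
  have hs₀C : s₀ • u ∈ C := by
    have h1 : ∑ i : Fin m, (m : ℝ)⁻¹ • (-(lam⁻¹ • b i)) ∈ C :=
      (convex_convexHull ℝ X).sum_mem (fun i _ => by positivity) (by simp [hmR.ne'])
        fun i _ => hsym _ (hbX i)
    convert h1 using 1
    rw [hu, hs₀, smul_neg, Finset.smul_sum, ← Finset.sum_neg_distrib]
    refine Finset.sum_congr rfl fun i _ => ?_
    rw [smul_neg, smul_smul, mul_inv, mul_comm]
  have hcont : Continuous fun s : ℝ => s • u := by fun_prop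
  have hR : IsCompact {s : ℝ | s • u ∈ C} := by
    have hemb : Topology.IsClosedEmbedding fun s : ℝ => s • u :=
      isClosedEmbedding_smul_left hu0
    exact hemb.isCompact_preimage hC
  obtain ⟨s, hsC, hsmax⟩ := hR.exists_isMaxOn ⟨s₀, hs₀C⟩ continuousOn_id
  have hs : s₀ ≤ s := hsmax hs₀C
  have hspos : 0 < s := hs₀pos.trans_le hs
  have hint : s • u ∉ interior C := by
    intro h
    have h1 : ∀ᶠ r in nhds s, r • u ∈ interior C :=
      hcont.continuousAt.eventually (isOpen_interior.mem_nhds h)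
    obtain ⟨r, hr, hsr⟩ := ((h1.filter_mono nhdsWithin_le_nhds).and
      (self_mem_nhdsWithin (s := Set.Ioi s))).exists
    exact absurd (hsmax (interior_subset hr : r • u ∈ C)) (not_le.2 hsr)
  obtain ⟨T, hTX, hTc, hT⟩ := exists_finset_card_le_finrank_of_notMem_interior hsC hint
  refine ⟨Finset.univ.image b ∪ T, ?_, ?_, ?_⟩
  · intro t ht
    simp only [Finset.coe_union, Finset.coe_image, Finset.coe_univ, Set.image_univ,
      Set.mem_union, Set.mem_range, Finset.mem_coe] at ht
    rcases ht with ⟨i, rfl⟩ | ht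
    · exact hbX i
    · exact hTX ht
  · have h1 : (Finset.univ.image b).card ≤ m := by
      simpa using Finset.card_image_le (s := (Finset.univ : Finset (Fin m))) (f := b)
    have := Finset.card_union_le (Finset.univ.image b) T
    omega
  · intro x hx p hp
    have hbx : ∀ i, inner ℝ (b i) x ≤ 1 := fun i => hx _ (by simp)
    have hyx : inner ℝ (s • u) x ≤ 1 := by
      have hconv : Convex ℝ {q : E | inner ℝ q x ≤ 1} := by
        refine convex_halfSpace_le ⟨fun a c => inner_add_left _ _ _, fun r a => ?_⟩ 1
        simp [real_inner_smul_left]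
      exact convexHull_min (fun t ht => hx t (by simp [Finset.mem_coe.1 ht])) hconv hT
    have hux : inner ℝ u x ≤ lam * m := by
      rw [real_inner_smul_left] at hyx
      have h1 : inner ℝ u x ≤ s⁻¹ := by
        rw [← mul_one s⁻¹]
        exact (le_inv_mul_iff₀ hspos).2 hyx
      have h2 : s⁻¹ ≤ s₀⁻¹ := inv_anti₀ hs₀pos hs
      rw [hs₀, inv_inv] at h2
      linarith
    have hpx : inner ℝ p x = ∑ i, b.repr p i * inner ℝ (b i) x := by
      conv_lhs => rw [← b.sum_repr p, sum_inner]
      simp [real_inner_smul_left]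
    have hux' : inner ℝ u x = -∑ i, inner ℝ (b i) x := by
      rw [hu, inner_neg_left, sum_inner]
    -- Only upper bounds on `⟨bᵢ, x⟩` are known, so the coefficients must be nonnegative; here they
    -- lie in `[0, 2]`.
    have hle : ∑ i, (1 - b.repr p i) * inner ℝ (b i) x ≤ ∑ _i : Fin m, (2 : ℝ) := by
      refine Finset.sum_le_sum fun i _ => ?_
      have := abs_le.1 (hb p hp i)
      nlinarith [hbx i]
    have hexp : ∑ i, (1 - b.repr p i) * inner ℝ (b i) x =
        ∑ i, inner ℝ (b i) x - ∑ i, b.repr p i * inner ℝ (b i) x := by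
      rw [← Finset.sum_sub_distrib]
      exact Finset.sum_congr rfl fun i _ => by ring
    simp only [Finset.sum_const, Finset.card_univ, Fintype.card_fin, nsmul_eq_mul] at hle
    linarith

/-! ### A center of small asymmetry, by Helly -/

/-- A convex body contains an interior point about which its Minkowski asymmetry is at most the
dimension. -/
theorem exists_mem_interior_forall_reflection_mem [Nontrivial E] {A : Set E} (hA : Convex ℝ A)
    (hAc : IsCompact A) (hAi : (interior A).Nonempty) :
    ∃ z ∈ interior A, ∀ x ∈ A, z - (Module.finrank ℝ E : ℝ)⁻¹ • (x - z) ∈ A := by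
  classical
  set m := Module.finrank ℝ E with hm
  have hm0 : 0 < m := Module.finrank_pos
  have hmR : (0 : ℝ) < m := by exact_mod_cast hm0
  -- `g x y = z` says exactly that `y = z - m⁻¹ • (x - z)`.
  let g : E → E → E := fun x y => ((m : ℝ) + 1)⁻¹ • x + ((m : ℝ) / (m + 1)) • y
  have hg : ∀ x, Continuous (g x) := fun x => by fun_prop
  obtain ⟨z, hz⟩ : (⋂ x : A, g x '' A).Nonempty := by
    refine Convex.helly_theorem_compact' (𝕜 := ℝ) (fun x => ?_) (fun x => hAc.image (hg _)) ?_
    · have := (hA.smul ((m : ℝ) / (m + 1))).translate (((m : ℝ) + 1)⁻¹ • (x : E))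
      rwa [← Set.image_smul, Set.image_image] at this
    · intro I hI
      obtain ⟨a, ha⟩ := hAi
      have haA := interior_subset ha
      -- The common point is the centroid of `I` padded to `m + 1` points by copies of `a`; dropping
      -- `x` leaves `m` points with centroid `y`.
      let k := m + 1 - I.card
      have hk : ((I.card : ℝ) + k) = m + 1 := by
        have : I.card + k = m + 1 := by omega
        exact_mod_cast this
      refine ⟨((m : ℝ) + 1)⁻¹ • (∑ x ∈ I, (x : E) + (k : ℝ) • a), ?_⟩
      simp only [Set.mem_iInter]
      intro x hx
      refine ⟨(m : ℝ)⁻¹ • (∑ y ∈ I.erase x, (y : E) + (k : ℝ) • a), ?_, ?_⟩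
      · have hcard : ((I.erase x).card : ℝ) + k = m := by
          have := Finset.card_erase_add_one hx
          have : ((I.erase x).card : ℝ) + 1 = I.card := by exact_mod_cast this
          linarith
        have := hA.sum_mem (t := Finset.univ (α := Option (I.erase x)))
          (w := fun o => o.elim ((m : ℝ)⁻¹ * k) fun _ => (m : ℝ)⁻¹)
          (z := fun o => o.elim a fun y => ((y : A) : E))
          (by rintro (_ | _) _ <;> dsimp only [Option.elim] <;> positivity)
          (by
            rw [Fintype.sum_option]
            simp only [Option.elim_none, Option.elim_some, Finset.sum_const, Finset.card_univ,
              Fintype.card_coe, nsmul_eq_mul]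
            rw [mul_comm _ ((m : ℝ)⁻¹), ← mul_add, add_comm, hcard, inv_mul_cancel₀ hmR.ne'])
          (by rintro (_ | y) _; exacts [haA, y.1.2])
        rw [Fintype.sum_option] at this
        simp only [Option.elim_none, Option.elim_some] at this
        rw [smul_add, Finset.smul_sum, smul_smul, add_comm, ← Finset.sum_coe_sort]
        exact this
      · simp only [g]
        rw [smul_smul, ← Finset.add_sum_erase I _ hx, add_assoc, smul_add]
        rw [smul_add _ (x : E)]
        congr 2
        field_simp
        rw [smul_add]
  have hz' : ∀ x ∈ A, ∃ y ∈ A, g x y = z := fun x hx => Set.mem_iInter.1 hz ⟨x, hx⟩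
  have hgsum : ((m : ℝ) + 1)⁻¹ + (m : ℝ) / (m + 1) = 1 := by field_simp; ring
  refine ⟨z, ?_, fun x hx => ?_⟩
  · obtain ⟨a, ha⟩ := hAi
    obtain ⟨y, hy, rfl⟩ := hz' a (interior_subset ha)
    exact hA.combo_interior_self_mem_interior ha hy (by positivity) (by positivity) hgsum
  · obtain ⟨y, hy, hyz⟩ := hz' x hx
    convert hy using 1
    have hx' : ((m : ℝ) + 1) • z = x + (m : ℝ) • y := by
      rw [← hyz]
      simp only [g, smul_add, smul_smul]
      congr 1
      · rw [mul_inv_cancel₀ (by positivity), one_smul]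
      · congr 1; field_simp
    have hx2 : x = ((m : ℝ) + 1) • z - (m : ℝ) • y := by rw [hx']; abel
    rw [hx2]
    match_scalars <;> field_simp
    ring

/-! ### From points of the polar back to members of the family -/

/-- A finite family of closed convex sets whose intersection is compact, contains the origin in
its interior and has asymmetry at most `lam` about the origin has a subfamily of at most
`2 * finrank` members whose intersection lies in a multiple of the reflected full intersection. -/
theorem exists_subfamily_neg_smul_mem [Nontrivial E] {ι : Type*} [Finite ι] {L : ι → Set E}
    (hcl : ∀ i, IsClosed (L i)) (hconv : ∀ i, Convex ℝ (L i)) (h0 : (0 : E) ∈ interior (⋂ i, L i))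
    (hcpt : IsCompact (⋂ i, L i)) {lam : ℝ} (hlam : 0 < lam)
    (hsym : ∀ x ∈ ⋂ i, L i, -(lam⁻¹ • x) ∈ ⋂ i, L i) :
    ∃ μ : Finset ι, μ.card ≤ 2 * Module.finrank ℝ E ∧
      ∀ x ∈ ⋂ i ∈ μ, L i, -(((lam + 2) * Module.finrank ℝ E)⁻¹ • x) ∈ ⋂ i, L i := by
  classical
  let P : ι → Set E := fun i => {p | ∀ v ∈ L i, inner ℝ p v ≤ 1}
  let X : Set E := ⋃ i, P i
  obtain ⟨r, hr, hball⟩ := Metric.isOpen_iff.1 isOpen_interior 0 h0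
  have hball' : ∀ i, Metric.ball 0 r ⊆ L i := fun i =>
    (hball.trans interior_subset).trans (Set.iInter_subset _ i)
  have h0L : ∀ i, (0 : E) ∈ L i := fun i => hball' i (Metric.mem_ball_self hr)
  have hPcpt : ∀ i, IsCompact (P i) := by
    intro i
    refine Metric.isCompact_of_isClosed_isBounded ?_ ?_
    · have : P i = ⋂ v ∈ L i, {p | inner ℝ p v ≤ 1} := by ext; simp [P]
      rw [this]
      exact isClosed_biInter fun v _ => isClosed_le (by fun_prop) continuous_const
    · refine (Metric.isBounded_closedBall (x := (0 : E)) (r := 2 / r)).subset fun p hp => ?_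
      rw [mem_closedBall_zero_iff]
      by_cases hp0 : p = 0
      · subst hp0; rw [norm_zero]; positivity
      have hn : 0 < ‖p‖ := norm_pos_iff.2 hp0
      have h1 := hp ((r / 2 / ‖p‖) • p) (hball' i (by
        rw [mem_ball_zero_iff, norm_smul, Real.norm_of_nonneg (by positivity),
          div_mul_cancel₀ _ hn.ne']
        linarith))
      rw [real_inner_smul_right, real_inner_self_eq_norm_sq] at h1
      rw [le_div_iff₀ hr]
      have h2 : r / 2 / ‖p‖ * ‖p‖ ^ 2 = r / 2 * ‖p‖ := by field_simp
      rw [h2] at h1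
      linarith
  have hX : IsCompact X := isCompact_iUnion hPcpt
  have hpolar : ∀ x, (∀ p ∈ X, inner ℝ p x ≤ 1) → x ∈ ⋂ i, L i := by
    intro x hx
    refine Set.mem_iInter.2 fun i => ?_
    refine mem_of_forall_polar_inner_le_one (hconv i) (hcl i) (h0L i) fun p hp => ?_
    rw [real_inner_comm]
    refine hx p (Set.mem_iUnion.2 ⟨i, fun v hv => ?_⟩)
    rw [real_inner_comm]
    exact hp v hv
  -- A nonzero vector orthogonal to `X` would span a line inside the bounded intersection.
  have hspan : Submodule.span ℝ X = ⊤ := by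
    rw [← Submodule.orthogonal_eq_bot_iff, Submodule.eq_bot_iff]
    intro u hu
    by_contra hu0
    obtain ⟨R, hR⟩ := hcpt.isBounded.exists_norm_le
    have hn : 0 < ‖u‖ := norm_pos_iff.2 hu0
    have h1 := hR (((|R| + 1) / ‖u‖) • u) (hpolar _ fun p hp => by
      rw [real_inner_smul_right, hu p (Submodule.subset_span hp)]
      simp)
    rw [norm_smul, Real.norm_of_nonneg (by positivity), div_mul_cancel₀ _ hn.ne'] at h1
    linarith [le_abs_self R]
  have h0X : (0 : E) ∈ X := by
    obtain ⟨i⟩ : Nonempty ι := by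
      by_contra hι
      rw [not_nonempty_iff] at hι
      have hXe : X = ∅ := by simp [X]
      rw [hXe, Submodule.span_empty] at hspan
      exact bot_ne_top hspan
    exact Set.mem_iUnion.2 ⟨i, fun v _ => by simp⟩
  have hXsym : ∀ p ∈ X, -(lam⁻¹ • p) ∈ convexHull ℝ X := by
    intro p hp
    refine mem_of_forall_polar_inner_le_one (convex_convexHull ℝ X)
      (isCompact_convexHull_of_isCompact hX).isClosed (subset_convexHull ℝ X h0X) fun x hx => ?_
    have hxL := hsym x (hpolar x fun q hq => hx q (subset_convexHull ℝ X hq))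
    obtain ⟨i, hi⟩ := Set.mem_iUnion.1 hp
    have := hi _ (Set.mem_iInter.1 hxL i)
    rwa [inner_neg_right, real_inner_smul_right, ← real_inner_smul_left, ← inner_neg_left] at this
  obtain ⟨T, hTX, hTc, hT⟩ := exists_sparse_polar_subset hX hspan hlam hXsym
  obtain ⟨i₀, -⟩ := Set.mem_iUnion.1 h0X
  have : Nonempty ι := ⟨i₀⟩
  choose! f hf using fun t (ht : t ∈ T) => Set.mem_iUnion.1 (hTX ht)
  refine ⟨T.image f, Finset.card_image_le.trans hTc, fun x hx => ?_⟩
  have hx' := hT x fun t ht =>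
    hf t ht x (Set.mem_iInter₂.1 hx _ (Finset.mem_image_of_mem f ht))
  have hm : (0 : ℝ) < Module.finrank ℝ E := by exact_mod_cast Module.finrank_pos
  refine hpolar _ fun p hp => ?_
  rw [inner_neg_right, real_inner_smul_right, ← mul_neg, inv_mul_le_iff₀ (by positivity), mul_one]
  exact hx' p hp

end SparsePolar

/-! ### Scaling factors and the main theorem -/

/-- Negative multiples of a convex set about one of its points increase with the factor. -/
theorem neg_smul_sub_singleton_subset {d : ℕ} {A : Set (EuclideanSpace ℝ (Fin d))}
    (hA : Convex ℝ A) {z : EuclideanSpace ℝ (Fin d)} (hz : z ∈ A) {a b : ℝ} (ha : 0 < a)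
    (hab : a ≤ b) : (-a) • (A - {z}) ⊆ (-b) • (A - {z}) := by
  have hb : 0 < b := ha.trans_le hab
  rw [Set.sub_singleton]
  rintro _ ⟨_, ⟨x, hx, rfl⟩, rfl⟩
  refine ⟨(a / b) • (x - z), ⟨z + (a / b) • (x - z), ?_, by simp⟩, ?_⟩
  · exact hA.add_smul_sub_mem hz hx ⟨by positivity, (div_le_one hb).2 hab⟩
  · simp only [smul_smul]
    congr 1
    field_simp

/-- A closed convex set between a convex body and a reflected multiple of it is a convex body,
and the factor bounds the homothetic distance. -/
theorem isFullConvexBody_and_homotheticDist_le {d : ℕ} {A B : Set (EuclideanSpace ℝ (Fin d))}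
    (hA : IsFullConvexBody A) (hB : IsClosed B) (hBc : Convex ℝ B) (hAB : A ⊆ B)
    {z : EuclideanSpace ℝ (Fin d)} {c : ℝ} (hc : 0 ≤ c) (h : B - {z} ⊆ (-c) • (A - {z})) :
    IsFullConvexBody B ∧ homotheticDist A B ≤ c := by
  refine ⟨⟨hBc, ?_, hA.nonempty_interior.mono (interior_mono hAB)⟩, ?_⟩
  · have hcpt : IsCompact ((-c) • (A - {z}) + {z}) :=
      by
      rw [Set.sub_singleton]
      exact ((hA.isCompact.image (by fun_prop)).smul _).add isCompact_singleton
    refine hcpt.of_isClosed_subset hB fun x hx => ?_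
    exact ⟨x - z, h ⟨x, hx, z, rfl, rfl⟩, z, rfl, by simp⟩
  · refine csInf_le ⟨0, ?_⟩ ⟨z, -c, by rw [abs_neg, abs_of_nonneg hc],
      Set.sub_subset_sub_right hAB, h⟩
    rintro _ ⟨_, t, rfl, _⟩
    exact abs_nonneg t

theorem mainTheorem3 (d : ℕ) (hd : 2 ≤ d) (n : ℕ)
    (K : Fin n → Set (EuclideanSpace ℝ (Fin d)))
    (hclosed : ∀ i, IsClosed (K i)) (hconvex : ∀ i, Convex ℝ (K i))
    (hK : IsFullConvexBody (⋂ i, K i)) :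
    ∃ z ∈ interior (⋂ i, K i), ∃ lam : ℝ, 1 ≤ lam ∧ lam ≤ (d : ℝ) ∧
      convexPolar ((⋂ i, K i) - {z}) ⊆ (-lam) • convexPolar ((⋂ i, K i) - {z}) ∧
      (∃ σ : Finset (Fin n), σ.card ≤ 2 * d + 1 ∧
        subfamilyInter K σ - {z} ⊆
          (-((lam + 1) * ((d : ℝ) + 1))) • ((⋂ i, K i) - {z}) ∧
        (-((lam + 1) * ((d : ℝ) + 1))) • ((⋂ i, K i) - {z}) ⊆
          (-(4 * (d : ℝ) ^ 2)) • ((⋂ i, K i) - {z}) ∧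
        IsFullConvexBody (subfamilyInter K σ) ∧
        homotheticDist (⋂ i, K i) (subfamilyInter K σ) ≤ (lam + 1) * ((d : ℝ) + 1)) ∧
      (∃ μ : Finset (Fin n), μ.card ≤ 2 * d ∧
        subfamilyInter K μ - {z} ⊆
          (-((lam + 1) * (2 * (d : ℝ) ^ 2 + 2 * (d : ℝ) + 1))) • ((⋂ i, K i) - {z}) ∧
        (-((lam + 1) * (2 * (d : ℝ) ^ 2 + 2 * (d : ℝ) + 1))) • ((⋂ i, K i) - {z}) ⊆
          (-(8 * (d : ℝ) ^ 3)) • ((⋂ i, K i) - {z}) ∧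
        IsFullConvexBody (subfamilyInter K μ) ∧
        homotheticDist (⋂ i, K i) (subfamilyInter K μ) ≤
          (lam + 1) * (2 * (d : ℝ) ^ 2 + 2 * (d : ℝ) + 1)) := by
  classical
  set A := ⋂ i, K i with hAdef
  have hdR : (2 : ℝ) ≤ d := by exact_mod_cast hd
  have hd0 : (0 : ℝ) < d := by linarith
  have hfin : Module.finrank ℝ (EuclideanSpace ℝ (Fin d)) = d := by simp
  have : Nontrivial (EuclideanSpace ℝ (Fin d)) :=
    Module.nontrivial_of_finrank_pos (R := ℝ) (by omega)
  obtain ⟨z, hzi, hz⟩ := exists_mem_interior_forall_reflection_mem hK.convex hK.isCompact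
    hK.nonempty_interior
  rw [hfin] at hz
  have hzA : z ∈ A := interior_subset hzi
  let L : Fin n → Set (EuclideanSpace ℝ (Fin d)) := fun i => (fun v => z + v) ⁻¹' K i
  have hLA : ⋂ i, L i = Homeomorph.addLeft z ⁻¹' A := by
    ext v; simp [L, hAdef]
  obtain ⟨μ, hμc, hμ⟩ := exists_subfamily_neg_smul_mem (L := L)
    (fun i => (hclosed i).preimage (by fun_prop)) (fun i => (hconvex i).translate_preimage_right z)
    (by rw [hLA, ← Homeomorph.preimage_interior]; simpa using hzi)
    (by rw [hLA]; exact (Homeomorph.isCompact_preimage _).2 hK.isCompact) hd0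
    (by
      rw [hLA]
      intro x hx
      have := hz _ hx
      simpa [sub_eq_add_neg] using this)
  rw [hfin] at hμc hμ
  have hbase : subfamilyInter K μ - {z} ⊆ (-(((d : ℝ) + 2) * d)) • (A - {z}) := by
    rw [Set.sub_singleton]
    rintro _ ⟨x, hx, rfl⟩
    have h1 := hμ (x - z) (by simpa [L, subfamilyInter] using hx)
    rw [hLA] at h1
    refine ⟨_, ⟨_, h1, z, rfl, rfl⟩, ?_⟩
    simp only [Homeomorph.coe_addLeft, add_sub_cancel_left, smul_neg, neg_smul, neg_neg]
    rw [smul_inv_smul₀ (by positivity)]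
  have hbase0 : (0 : ℝ) < ((d : ℝ) + 2) * d := by positivity
  have hmono {a b : ℝ} (ha : 0 < a) (hab : a ≤ b) :=
    neg_smul_sub_singleton_subset hK.convex hzA ha hab
  have hBcl : IsClosed (subfamilyInter K μ) := isClosed_biInter fun i _ => hclosed i
  have hBcv : Convex ℝ (subfamilyInter K μ) := convex_iInter₂ fun i _ => hconvex i
  have hAB : A ⊆ subfamilyInter K μ := fun x hx =>
    Set.mem_iInter₂.2 fun i _ => Set.mem_iInter.1 hx i
  -- The same `μ` also serves as `σ`: `d(d + 2)` is below both required factors at `lam = d`.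
  refine ⟨z, hzi, d, by linarith, le_rfl, ?_, ⟨μ, by omega, ?_⟩, ⟨μ, hμc, ?_⟩⟩
  · intro p hp
    refine ⟨-((d : ℝ)⁻¹ • p), ?_, ?_⟩
    · rw [Set.sub_singleton]
      rintro _ ⟨x, hx, rfl⟩
      have := hp _ ⟨_, hz x hx, z, rfl, rfl⟩
      rw [inner_neg_left, real_inner_smul_left, ← real_inner_smul_right, ← inner_neg_right]
      simpa using this
    · simp only [smul_neg, neg_smul, neg_neg]
      rw [smul_inv_smul₀ hd0.ne']
  · have h1 : ((d : ℝ) + 2) * d ≤ (d + 1) * (d + 1) := by nlinarith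
    have h2 := hbase.trans (hmono hbase0 h1)
    exact ⟨h2, hmono (by positivity) (by nlinarith),
      isFullConvexBody_and_homotheticDist_le hK hBcl hBcv hAB (by positivity) h2⟩
  · have h1 : ((d : ℝ) + 2) * d ≤ (d + 1) * (2 * (d : ℝ) ^ 2 + 2 * d + 1) := by nlinarith
    have h2 := hbase.trans (hmono hbase0 h1)
    exact ⟨h2, hmono (by positivity) (by nlinarith [mul_nonneg (sub_nonneg.2 hdR) (sq_nonneg (d : ℝ))]),
      isFullConvexBody_and_homotheticDist_le hK hBcl hBcv hAB (by positivity) h2⟩
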